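/- Let $m,n\in\mathbb N$, $\tilde A\in\mathbb R^{m\times n}$, $y\in\mathbb R^m$, $\alpha>0$, $w_1,\dots,w_n>0$ and $p\in[0,1]$. Put $$\varphi(v):=\|\tilde A v-y\|^2+\alpha\sum_{i=1}^n w_i|v_i|^p,\qquad v\in\mathbb R^n,$$ with the convention $0^0=0$ (so for $p=0$ the penalty counts the nonzero entries with weights), and let $\partial\varphi$ denote the limiting (Mordukhovich) subdifferential. Let $\bar v$ be a (global) minimizer of $\varphi$, let $\bar r:=2\tilde A^T(\tilde A\bar v-y)$, $\underline{\mathcal I}:=\{i\mid \bar v_i\neq0\}$, and $$\overline{\mathcal I}:=\underline{\mathcal I}\cup\begin{cases}\{i\mid \bar v_i=0,\ |\bar r_i|=\alpha w_i\},&p=1,\\ \emptyset,&p\in(0,1),\\ \{i\mid \bar v_i=\bar r_i=0\},&p=0.\end{cases}$$ For $\mathcal I\subseteq\{1,\dots,n\}$ let $P^{\mathcal I},W^{\mathcal I}$ be the diagonal $n\times n$ matrices with $P^{\mathcal I}_{ii}=1$ if $i\in\mathcal I$ and $0$ otherwise, and $W^{\mathcal I}_{ii}=1$ if $i\notin\mathcal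 I$, $W^{\mathcal I}_{ii}=0$ if $i\in\mathcal I$ and $p\in\{0,1\}$, $W^{\mathcal I}_{ii}=\alpha w_i p(p-1)|\bar v_i|^{p-2}$ if $i\in\mathcal I$ and $p\in(0,1)$. For a set-valued mapping $G:\mathbb R^n\rightrightarrows\mathbb R^n$, the SC derivative $\mathcal SG(x,y)$ at $(x,y)\in\operatorname{gph}G$ is the set of all $n$-dimensional subspaces $L\subseteq\mathbb R^n\times\mathbb R^n$ which are limits (in the norm of the orthogonal projections) of tangent cones $T_{\operatorname{gph}G}(x_k,y_k)$, where $(x_k,y_k)\in\operatorname{gph}G$ converges to $(x,y)$ and each of these (Bouligand) tangent cones is an $n$-dimensional subspace. $G$ is called SCD-regular at $(x,y)$ if every $L\in\mathcal SG(x,y)$ satisfies: $(s,0)\in L$ implies $s=0$. Then $0\in\partial\varphi(\bar v)$, and $\partial\varphi$ is SCD-regular at $(\bar v,0)$ if and only if for every index set $\mathcal I$ with $\underline{\mathcal I}\subseteq\mathcal I\subseteq\overline{\mathcal I}$ the matrix $2P^{\mathcal I}\tilde A^T\tilde AP^{\mathcal I}+W^{\mathcal I}$ is nonsingular. For $p\in\{0,1\}$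 the latter condition is equivalent to nonsingularity of $\tilde A_{\mathcal I}^T\tilde A_{\mathcal I}$ for every $\mathcal I$ with $\underline{\mathcal I}\subseteq\mathcal I\subseteq\overline{\mathcal I}$, where $\tilde A_{\mathcal I}$ is the submatrix of $\tilde A$ formed by the columns with index in $\mathcal I$. -/

import Mathlib

open Filter Topology Matrix

noncomputable section

namespace SCD

/-! ### Variational analysis -/

/-- The (Bouligand) tangent cone to `Ω` at `x`: all limits of sequences `u k` for which there are
`t k > 0` with `t k → 0` and `x + t k • u k ∈ Ω`. -/
def bouligandCone {F : Type*} [NormedAddCommGroup F] [NormedSpace ℝ F] (Ω : Set F) (x : F) :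
    Set F :=
  {v | ∃ (t : ℕ → ℝ) (u : ℕ → F), (∀ k, 0 < t k) ∧ Tendsto t atTop (𝓝 0) ∧
    Tendsto u atTop (𝓝 v) ∧ ∀ k, x + t k • u k ∈ Ω}

/-- The regular (Fréchet) subdifferential of a real-valued function; the lower limit is taken in
the extended reals. -/
def regularSubdiff {n : ℕ} (q : EuclideanSpace ℝ (Fin n) → ℝ) (x₀ : EuclideanSpace ℝ (Fin n)) :
    Set (EuclideanSpace ℝ (Fin n)) :=
  {s | 0 ≤ liminf (fun x => (((q x - q x₀ - inner ℝ s (x - x₀)) / ‖x - x₀‖ : ℝ) : EReal))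
    (𝓝[≠] x₀)}

/-- The limiting (Mordukhovich) subdifferential of a real-valued function. -/
def limitingSubdiff {n : ℕ} (q : EuclideanSpace ℝ (Fin n) → ℝ) (x₀ : EuclideanSpace ℝ (Fin n)) :
    Set (EuclideanSpace ℝ (Fin n)) :=
  {s | ∃ x σ : ℕ → EuclideanSpace ℝ (Fin n),
    Tendsto x atTop (𝓝 x₀) ∧ Tendsto σ atTop (𝓝 s) ∧ (∀ k, σ k ∈ regularSubdiff q (x k)) ∧
    Tendsto (fun k => q (x k)) atTop (𝓝 (q x₀))}

/-! ### Subspace containing derivatives of set-valued mappings -/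

/-- `ℝⁿ × ℝⁿ` with its Euclidean norm and inner product. -/
abbrev PairSpace (n : ℕ) : Type :=
  WithLp 2 (EuclideanSpace ℝ (Fin n) × EuclideanSpace ℝ (Fin n))

/-- The graph of a set-valued mapping `G : ℝⁿ ⇉ ℝⁿ`. -/
def graph {n : ℕ} (G : EuclideanSpace ℝ (Fin n) → Set (EuclideanSpace ℝ (Fin n))) :
    Set (PairSpace n) :=
  {z | z.snd ∈ G z.fst}

/-- The `n`-dimensional subspaces of `ℝⁿ × ℝⁿ`. -/
def subspacesZ (n : ℕ) : Set (Submodule ℝ (PairSpace n)) :=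
  {L | Module.finrank ℝ L = n}

/-- The distance of two subspaces: the operator norm of the difference of the orthogonal
projections onto them. -/
def distZ {n : ℕ} (L₁ L₂ : Submodule ℝ (PairSpace n)) : ℝ :=
  ‖L₁.starProjection - L₂.starProjection‖

/-- `G` is graphically smooth of dimension `n` at `z ∈ gph G`, and its tangent cone there is the
`n`-dimensional subspace `L`. -/
def IsGraphTangentSpace {n : ℕ} (G : EuclideanSpace ℝ (Fin n) → Set (EuclideanSpace ℝ (Fin n)))
    (z : PairSpace n) (L : Submodule ℝ (PairSpace n)) : Prop :=
  z ∈ graph G ∧ L ∈ subspacesZ n ∧ bouligandCone (graph G) z = (L : Set (PairSpace n))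

/-- The subspace containing (SC) derivative of `G` at `(x, y)`: all `n`-dimensional subspaces that
are limits of the tangent spaces of `gph G` at points of graphical smoothness which converge to
`(x, y)`. -/
def scDerivative {n : ℕ} (G : EuclideanSpace ℝ (Fin n) → Set (EuclideanSpace ℝ (Fin n)))
    (x y : EuclideanSpace ℝ (Fin n)) : Set (Submodule ℝ (PairSpace n)) :=
  {L | L ∈ subspacesZ n ∧ ∃ (z : ℕ → PairSpace n) (T : ℕ → Submodule ℝ (PairSpace n)),
    (∀ k, IsGraphTangentSpace G (z k) (T k)) ∧ Tendsto z atTop (𝓝 (WithLp.toLp 2 (x, y))) ∧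
    Tendsto (fun k => distZ L (T k)) atTop (𝓝 0)}

/-- The regular subspaces: those `n`-dimensional `L` with `(s, 0) ∈ L → s = 0`. -/
def regularZ (n : ℕ) : Set (Submodule ℝ (PairSpace n)) :=
  {L | L ∈ subspacesZ n ∧
    ∀ s : EuclideanSpace ℝ (Fin n), (WithLp.toLp 2 (s, 0) : PairSpace n) ∈ L → s = 0}

/-- `G` is SCD-regular at a point `(x, y)` of its graph. -/
def IsSCDRegularAt {n : ℕ} (G : EuclideanSpace ℝ (Fin n) → Set (EuclideanSpace ℝ (Fin n)))
    (x y : EuclideanSpace ℝ (Fin n)) : Prop :=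
  scDerivative G x y ⊆ regularZ n

/-! ### The `ℓ_p`-regularized least squares problem -/

/-- `|t|^p`, with the convention `0^0 = 0`, so that `p = 0` counts nonzero entries. -/
def absPow (p t : ℝ) : ℝ :=
  if p = 0 then (if t = 0 then 0 else 1) else |t| ^ p

/-- The objective `‖A v - y‖² + α ∑ i, w i * |v i|^p`. -/
def objective {m n : ℕ} (A : Matrix (Fin m) (Fin n) ℝ) (y : EuclideanSpace ℝ (Fin m))
    (α p : ℝ) (w : Fin n → ℝ) (v : EuclideanSpace ℝ (Fin n)) : ℝ :=
  ‖WithLp.toLp 2 (A *ᵥ v.ofLp) - y‖ ^ 2 + α * ∑ i, w i * absPow p (v i)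

/-- The gradient `2 Aᵀ (A v - y)` of the smooth part. -/
def fidelityGrad {m n : ℕ} (A : Matrix (Fin m) (Fin n) ℝ) (y : EuclideanSpace ℝ (Fin m))
    (v : EuclideanSpace ℝ (Fin n)) : Fin n → ℝ :=
  (2 : ℝ) • (Aᵀ *ᵥ (A *ᵥ v.ofLp - y.ofLp))

/-- The smallest admissible index set: the support of `v`. -/
def lowerIndexSet {n : ℕ} (v : EuclideanSpace ℝ (Fin n)) : Finset (Fin n) :=
  {i | v i ≠ 0}

/-- The largest admissible index set, where `r` is the gradient of the smooth part at `v`. -/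
def upperIndexSet {n : ℕ} (α p : ℝ) (w r : Fin n → ℝ) (v : EuclideanSpace ℝ (Fin n)) :
    Finset (Fin n) :=
  lowerIndexSet v ∪
    (if p = 1 then ({i | v i = 0 ∧ |r i| = α * w i} : Finset (Fin n))
     else if p = 0 then ({i | v i = 0 ∧ r i = 0} : Finset (Fin n))
     else ∅)

/-- The diagonal matrix `P^I`. -/
def matP {n : ℕ} (I : Finset (Fin n)) : Matrix (Fin n) (Fin n) ℝ :=
  Matrix.diagonal fun i => if i ∈ I then 1 else 0

/-- The diagonal matrix `W^I`. -/
def matW {n : ℕ} (α p : ℝ) (w : Fin n → ℝ) (v : EuclideanSpace ℝ (Fin n)) (I : Finset (Fin n)) :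
    Matrix (Fin n) (Fin n) ℝ :=
  Matrix.diagonal fun i =>
    if i ∈ I then
      (if p = 0 ∨ p = 1 then 0 else α * w i * p * (p - 1) * |v i| ^ (p - 2))
    else 1

/-- The submatrix of `A` consisting of the columns with index in `I`. -/
def colSubmatrix {m n : ℕ} (A : Matrix (Fin m) (Fin n) ℝ) (I : Finset (Fin n)) :
    Matrix (Fin m) I ℝ :=
  A.submatrix id (fun i : I => (i : Fin n))

end SCD

end

/-! ### The scalar penalty `c |t|^p`: slope, curvature, subdifferential. -/

namespace SCD

/-! The fidelity term is quadratic and the penalty is separable. Subtracting the affine gradient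
from the second component therefore turns the graph of the subdifferential into a product of planar
curves, the graphs of the subdifferential of `c |t|^p` (`limitingSubdiff_objective`,
`mem_graph_add_iff`). Such a curve is smooth where `t ≠ 0`, with slope given by the curvature of the
penalty, and contains a vertical piece over `t = 0`. It has corners at `(0, ±c)` for `p = 1` and a
crossing at the origin for `p = 0`. For `0 < p < 1` the branches go off to infinity near `t = 0` and
never meet the vertical line.

Hence, wherever the tangent cone is an `n`-dimensional subspace, it lies in `tangentSpace` for the
support of the base point (`tangent_le_tangentSpace`). Conversely, that space is the whole cone away
from corners and crossings (`isGraphTangentSpace_tangentSpace`).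

The supports that can occur near `(v, 0)` are the index sets `I` between the two bounds: a
coordinate vanishing in the limit can be approached through nonzero values only at a corner or
crossing. Each such `I` does occur, and its limit space belongs to the SC derivative
(`tangentSpace_mem_scDerivative`). For an arbitrary limit `L`, a vector `(s, 0)` of `L` satisfies
the equations of one of these spaces (`eq_zero_of_mem_scDerivative`). The vectors `(s, 0)` in the
space of `I` are exactly the kernel of the reduced matrix (`reduced_mulVec_eq_zero_iff`), which
gives the equivalence. Minimality enters only through `0 ∈ ∂φ(v)`. -/

/-- The derivative of `t ↦ c |t|^p` away from the origin. -/
noncomputable def powSlope (c p t : ℝ) : ℝ := c * p * |t| ^ (p - 2) * t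

/-- The second derivative of `t ↦ c |t|^p` away from the origin. -/
noncomputable def powCurvature (c p t : ℝ) : ℝ := c * p * (p - 1) * |t| ^ (p - 2)

/-- The limiting subdifferential of `t ↦ c |t|^p` on the real line. -/
def powSubdiff (c p t : ℝ) : Set ℝ :=
  {s | (t ≠ 0 → s = powSlope c p t) ∧ (t = 0 → p = 1 → |s| ≤ c)}

lemma absPow_of_ne {p t : ℝ} (ht : t ≠ 0) : absPow p t = |t| ^ p := by
  unfold absPow
  split_ifs with h
  · simp [h]
  · rfl

lemma absPow_zero (p : ℝ) : absPow p 0 = 0 := by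
  unfold absPow
  by_cases h : p = 0
  · simp [h]
  · simp [h, Real.zero_rpow h]

lemma hasDerivAt_abs_rpow_of_ne {t : ℝ} (q : ℝ) (ht : t ≠ 0) :
    HasDerivAt (fun x : ℝ => |x| ^ q) (q * |t| ^ (q - 2) * t) t := by
  have h := (hasDerivAt_abs ht).rpow_const (p := q) (Or.inl (abs_ne_zero.2 ht))
  convert h using 1
  have h0 : 0 < |t| := abs_pos.2 ht
  have h1 : |t| ^ (q - 1) = |t| ^ (q - 2) * |t| := by
    rw [← Real.rpow_add_one h0.ne']; congr 1; ring
  have h2 : (SignType.sign t : ℝ) * |t| = t := sign_mul_abs t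
  rw [h1]
  linear_combination -(q * |t| ^ (q - 2)) * h2

lemma hasDerivAt_absPow {t : ℝ} (c p : ℝ) (ht : t ≠ 0) :
    HasDerivAt (fun x : ℝ => c * absPow p x) (powSlope c p t) t := by
  have h := (hasDerivAt_abs_rpow_of_ne p ht).const_mul c
  have h' : HasDerivAt (fun x : ℝ => c * |x| ^ p) (powSlope c p t) t := by
    refine h.congr_deriv ?_
    unfold powSlope; ring
  refine h'.congr_of_eventuallyEq ?_
  filter_upwards [isOpen_ne.mem_nhds ht] with x hx
  rw [absPow_of_ne hx]

lemma hasDerivAt_powSlope {t : ℝ} (c p : ℝ) (ht : t ≠ 0) :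
    HasDerivAt (powSlope c p) (powCurvature c p t) t := by
  have h := (((hasDerivAt_abs_rpow_of_ne (p - 2) ht).const_mul (c * p)).mul (hasDerivAt_id t))
  refine h.congr_deriv ?_
  have h0 : 0 < |t| := abs_pos.2 ht
  have h1 : |t| ^ (p - 2) = |t| ^ (p - 2 - 2) * t ^ 2 := by
    rw [← sq_abs t, ← Real.rpow_natCast, ← Real.rpow_add h0]; congr 1; push_cast; ring
  simp only [powCurvature, id]
  rw [h1]
  ring

/-- This identity measures the blow-up of the slope at the origin for `0 < p < 1`; for `p = 1` it
says that slopes have modulus `c`. -/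
lemma abs_powSlope_mul {t c p : ℝ} (ht : t ≠ 0) (hc : 0 ≤ c) (hp : 0 ≤ p) :
    |powSlope c p t| * |t| ^ (1 - p) = c * p := by
  have h0 : 0 < |t| := abs_pos.2 ht
  have h1 : |t| ^ (p - 2) * |t| * |t| ^ (1 - p) = 1 := by
    rw [← Real.rpow_add_one h0.ne', ← Real.rpow_add h0]
    convert Real.rpow_zero _ using 2; ring
  rw [powSlope, abs_mul, abs_mul, abs_of_nonneg (mul_nonneg hc hp),
    abs_of_nonneg (Real.rpow_nonneg h0.le _)]
  linear_combination (c * p) * h1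

lemma powSlope_one_of_pos {t : ℝ} (c : ℝ) (ht : 0 < t) : powSlope c 1 t = c := by
  have : t ^ (-1 : ℝ) * t = 1 := by rw [Real.rpow_neg_one]; field_simp
  unfold powSlope
  rw [abs_of_pos ht]; norm_num
  linear_combination c * this

lemma powSlope_neg (c p t : ℝ) : powSlope c p (-t) = -powSlope c p t := by
  simp [powSlope]

lemma powSlope_one_of_neg {t : ℝ} (c : ℝ) (ht : t < 0) : powSlope c 1 t = -c := by
  rw [← neg_neg t, powSlope_neg, powSlope_one_of_pos c (neg_pos.2 ht)]

@[simp] lemma powSlope_zero (c t : ℝ) : powSlope c 0 t = 0 := by simp [powSlope]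

/-- The slopes of `c |t|^p` with `0 < p < 1` are unbounded near the origin. -/
lemma not_tendsto_powSlope {ι : Type*} {l : Filter ι} [l.NeBot] {c p b : ℝ} (hc : 0 < c)
    (hp : 0 < p) (hp1 : p < 1) {x : ι → ℝ} (hx : Tendsto x l (𝓝 0)) (hx0 : ∀ᶠ k in l, x k ≠ 0) :
    ¬ Tendsto (fun k => powSlope c p (x k)) l (𝓝 b) := by
  intro h
  have h1 : Tendsto (fun k => |x k| ^ (1 - p)) l (𝓝 0) := by
    have := (hx.abs).rpow_const (p := 1 - p) (Or.inr (by linarith))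
    simpa [Real.zero_rpow (show (1 - p) ≠ 0 by linarith)] using this
  have h2 := h.abs.mul h1
  have h3 : Tendsto (fun _ : ι => c * p) l (𝓝 (|b| * 0)) :=
    h2.congr' (hx0.mono fun k hk => abs_powSlope_mul hk hc.le hp.le)
  have h4 := tendsto_nhds_unique h3 tendsto_const_nhds
  have : 0 < c * p := by positivity
  simp at h4
  rcases h4 with h4 | h4 <;> linarith

/-- The graph of the one-dimensional subdifferential is closed. -/
lemma powSubdiff_closed {ι : Type*} {l : Filter ι} [l.NeBot] {c p a b : ℝ} {x s : ι → ℝ}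
    (hc : 0 ≤ c) (hx : Tendsto x l (𝓝 a)) (hs : Tendsto s l (𝓝 b))
    (h : ∀ k, s k ∈ powSubdiff c p (x k)) : b ∈ powSubdiff c p a := by
  refine ⟨fun ha => ?_, fun _ hp => ?_⟩
  · have h1 := (hasDerivAt_powSlope c p ha).continuousAt.tendsto.comp hx
    refine tendsto_nhds_unique hs (h1.congr' ?_)
    filter_upwards [hx.eventually_ne ha] with k hk
    exact ((h k).1 hk).symm
  · refine le_of_tendsto hs.abs (Eventually.of_forall fun k => ?_)
    by_cases hk : x k = 0
    · exact (h k).2 hk hp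
    · rw [(h k).1 hk, hp]
      rcases lt_or_gt_of_ne hk with h0 | h0
      · rw [powSlope_one_of_neg c h0, abs_neg, abs_of_nonneg hc]
      · rw [powSlope_one_of_pos c h0, abs_of_nonneg hc]

/-- `powSubdiff` is the regular subdifferential of `c |t|^p`. -/
lemma mem_powSubdiff_iff {c p t s : ℝ} (hc : 0 < c) (hp1 : p ≤ 1) :
    s ∈ powSubdiff c p t ↔ ∀ ε > 0, ∀ᶠ h in 𝓝 (0 : ℝ),
      -(ε * |h|) ≤ c * absPow p (t + h) - c * absPow p t - s * h := by
  by_cases ht : t = 0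
  · subst ht
    simp only [zero_add, absPow_zero, mul_zero, sub_zero]
    by_cases hp : p = 1
    · subst hp
      have hq : ∀ h, absPow 1 h = |h| := fun h => by simp [absPow]
      simp only [hq]
      constructor
      · rintro ⟨-, h2⟩ ε hε
        refine Eventually.of_forall fun h => ?_
        have h3 : s * h ≤ c * |h| := (le_abs_self _).trans (by
          rw [abs_mul]; exact mul_le_mul_of_nonneg_right (h2 rfl rfl) (abs_nonneg _))
        have : 0 ≤ ε * |h| := by positivity
        linarith
      · intro H
        refine ⟨fun h => absurd rfl h, fun _ _ => ?_⟩
        refine le_of_forall_pos_le_add fun ε hε => ?_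
        obtain ⟨δ, hδ, hb⟩ := Metric.eventually_nhds_iff.1 (H ε hε)
        -- Testing one positive and one negative increment bounds `s` from both sides.
        have e1 := @hb (δ / 2) (by simp [abs_of_pos hδ, hδ])
        have e2 := @hb (-(δ / 2)) (by simp [abs_of_pos hδ, hδ])
        rw [abs_neg] at e2
        rw [abs_of_pos (by positivity : 0 < δ / 2)] at e1 e2
        rw [abs_le]
        constructor
        · by_contra hcon; nlinarith
        · by_contra hcon; nlinarith
    · have hp2 : p < 1 := lt_of_le_of_ne hp1 hp
      refine iff_of_true ⟨fun h => absurd rfl h, fun _ h => absurd h hp⟩ fun ε hε => ?_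
      -- For `p < 1` the penalty dominates every linear function near the origin, so every `s` is a
      -- subgradient.
      have h1 : Tendsto (fun h : ℝ => |s| * |h| ^ (1 - p)) (𝓝 0) (𝓝 0) := by
        have := ((continuous_abs.tendsto (0 : ℝ)).rpow_const (p := 1 - p)
          (Or.inr (by linarith))).const_mul |s|
        simpa [Real.zero_rpow (show (1 - p) ≠ 0 by linarith)] using this
      filter_upwards [h1.eventually_lt_const hc] with h hh
      by_cases h0 : h = 0
      · simp [h0, absPow_zero]
      · have h0' : 0 < |h| := abs_pos.2 h0
        have e : |h| ^ (1 - p) * |h| ^ p = |h| := by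
          rw [← Real.rpow_add h0']; simp
        rw [absPow_of_ne h0]
        have e2 : s * h ≤ |s| * |h| := (le_abs_self _).trans (abs_mul _ _).le
        have e3 : |s| * |h| ≤ c * |h| ^ p := by
          calc |s| * |h| = |s| * |h| ^ (1 - p) * |h| ^ p := by rw [mul_assoc, e]
            _ ≤ _ := mul_le_mul_of_nonneg_right hh.le (Real.rpow_nonneg h0'.le _)
        have : 0 ≤ ε * |h| := by positivity
        linarith
  · have hd := hasDerivAt_iff_isLittleO_nhds_zero.1 (hasDerivAt_absPow c p ht)
    constructor
    · rintro ⟨h1, -⟩ ε hε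
      filter_upwards [hd.def hε] with h hh
      rw [h1 ht]
      have := (abs_le.1 hh).1
      simp only [smul_eq_mul, Real.norm_eq_abs] at this
      linarith
    · intro H
      refine ⟨fun _ => ?_, fun h => absurd h ht⟩
      have key : ∀ ε > 0, |s - powSlope c p t| ≤ 2 * ε := by
        intro ε hε
        obtain ⟨δ, hδ, hb⟩ := Metric.eventually_nhds_iff.1 ((H ε hε).and (hd.def hε))
        have e1 := @hb (δ / 2) (by simp [abs_of_pos hδ, hδ])
        have e2 := @hb (-(δ / 2)) (by simp [abs_of_pos hδ, hδ])
        simp only [smul_eq_mul, Real.norm_eq_abs, abs_neg] at e1 e2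
        rw [abs_of_pos (by positivity : 0 < δ / 2)] at e1 e2
        have e3 := abs_le.1 e1.2
        have e4 := abs_le.1 e2.2
        rw [abs_le]
        constructor
        · by_contra hcon; nlinarith
        · by_contra hcon; nlinarith
      have : |s - powSlope c p t| ≤ 0 := by
        refine le_of_forall_pos_le_add fun ε hε => ?_
        have := key (ε / 2) (by positivity)
        linarith
      exact sub_eq_zero.1 (abs_nonpos_iff.1 this)

/-! ### Tangents to the graph of the one-dimensional subdifferential -/

/-- Away from the origin the curve is locally the graph of the differentiable function `powSlope`,
so a tangent vector `(a, b)` obeys its derivative. -/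
lemma powCurvature_tangent {c p x b₀ a b : ℝ} {t A B : ℕ → ℝ} (ht : ∀ k, 0 < t k)
    (ht0 : Tendsto t atTop (𝓝 0)) (hA : Tendsto A atTop (𝓝 a)) (hB : Tendsto B atTop (𝓝 b))
    (h₀ : b₀ ∈ powSubdiff c p x) (h : ∀ k, b₀ + t k * B k ∈ powSubdiff c p (x + t k * A k))
    (hx : x ≠ 0) : b = powCurvature c p x * a := by
  have hlim : Tendsto (fun k => x + t k * A k) atTop (𝓝 x) := by
    simpa using (ht0.mul hA).const_add x
  have hd := (hasFDerivWithinAt_univ.2 (hasDerivAt_powSlope c p hx).hasFDerivAt).lim (c := fun k => (t k)⁻¹)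
    (d := fun k => t k * A k) (v := a) (l := atTop)
    (by simpa using ht0.mul hA) (Eventually.of_forall fun _ => trivial)
    (hA.congr fun k => by simp [(ht k).ne'])
  have h2 := tendsto_nhds_unique hB (hd.congr' ?_)
  · rw [h2]; simp [mul_comm]
  · filter_upwards [hlim.eventually_ne hx] with k hk
    rw [← (h k).1 hk, ← h₀.1 hx]
    have := (ht k).ne'
    simp [this]

lemma eventually_eq_powSlope {c p b₀ a : ℝ} {t A B : ℕ → ℝ} (ht : ∀ k, 0 < t k)
    (hA : Tendsto A atTop (𝓝 a))
    (h : ∀ k, b₀ + t k * B k ∈ powSubdiff c p (0 + t k * A k)) (ha : a ≠ 0) :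
    ∀ᶠ k in atTop, b₀ + t k * B k = powSlope c p (t k * A k) := by
  filter_upwards [hA.eventually_ne ha] with k hk
  have := (h k).1
  rw [zero_add] at this
  exact this (mul_ne_zero (ht k).ne' hk)

/-- A horizontal component would force points with nonzero abscissa to approach `(0, b₀)`, where the
slopes are unbounded. -/
lemma tangent_eq_zero_of_lt_one {c p b₀ a b : ℝ} {t A B : ℕ → ℝ} (hc : 0 < c) (hp : 0 < p)
    (hp1 : p < 1) (ht : ∀ k, 0 < t k) (ht0 : Tendsto t atTop (𝓝 0)) (hA : Tendsto A atTop (𝓝 a))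
    (hB : Tendsto B atTop (𝓝 b))
    (h : ∀ k, b₀ + t k * B k ∈ powSubdiff c p (0 + t k * A k)) : a = 0 := by
  by_contra ha
  refine not_tendsto_powSlope (x := fun k => t k * A k) (b := b₀) (l := atTop) hc hp hp1
    (by simpa using ht0.mul hA) ?_ ?_
  · filter_upwards [hA.eventually_ne ha] with k hk
    exact mul_ne_zero (ht k).ne' hk
  · have h1 : Tendsto (fun k => b₀ + t k * B k) atTop (𝓝 b₀) := by
      simpa using (ht0.mul hB).const_add b₀
    exact h1.congr' (eventually_eq_powSlope ht hA h ha)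

/-- For `p = 0` any movement off the vertical axis stays on the horizontal one, so it can start only
at the crossing and is itself horizontal. -/
lemma tangent_zero {c b₀ a b : ℝ} {t A B : ℕ → ℝ}
    (ht : ∀ k, 0 < t k) (ht0 : Tendsto t atTop (𝓝 0)) (hA : Tendsto A atTop (𝓝 a))
    (hB : Tendsto B atTop (𝓝 b))
    (h : ∀ k, b₀ + t k * B k ∈ powSubdiff c 0 (0 + t k * A k)) (ha : a ≠ 0) :
    b₀ = 0 ∧ b = 0 := by
  have h1 := eventually_eq_powSlope ht hA h ha
  simp only [powSlope_zero] at h1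
  have h2 : Tendsto (fun k => b₀ + t k * B k) atTop (𝓝 b₀) := by
    simpa using (ht0.mul hB).const_add b₀
  have h3 : b₀ = 0 := tendsto_nhds_unique (h2.congr' h1) tendsto_const_nhds
  refine ⟨h3, tendsto_nhds_unique (hB.congr' (h1.mono fun k hk => ?_)) tendsto_const_nhds⟩
  rw [h3, zero_add] at hk
  exact (mul_eq_zero.1 hk).resolve_left (ht k).ne'

/-- The vertical segment can be left only through its ends, to the right at the top and to the left
at the bottom. -/
lemma tangent_one {c b₀ a b : ℝ} {t A B : ℕ → ℝ}
    (ht : ∀ k, 0 < t k) (ht0 : Tendsto t atTop (𝓝 0)) (hA : Tendsto A atTop (𝓝 a))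
    (hB : Tendsto B atTop (𝓝 b))
    (h : ∀ k, b₀ + t k * B k ∈ powSubdiff c 1 (0 + t k * A k)) :
    (0 < a → b₀ = c) ∧ (a < 0 → b₀ = -c) := by
  have h2 : Tendsto (fun k => b₀ + t k * B k) atTop (𝓝 b₀) := by
    simpa using (ht0.mul hB).const_add b₀
  constructor
  · intro ha
    refine tendsto_nhds_unique (h2.congr' ?_) tendsto_const_nhds
    filter_upwards [eventually_eq_powSlope ht hA h ha.ne', hA.eventually_const_lt ha] with k hk hk'
    rw [hk, powSlope_one_of_pos _ (mul_pos (ht k) hk')]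
  · intro ha
    refine tendsto_nhds_unique (h2.congr' ?_) tendsto_const_nhds
    filter_upwards [eventually_eq_powSlope ht hA h ha.ne, hA.eventually_lt_const ha] with k hk hk'
    rw [hk, powSlope_one_of_neg _ (mul_neg_of_pos_of_neg (ht k) hk')]

end SCD

namespace SCD

/-! ### The subdifferential of the objective -/

variable {m n : ℕ}

/-- The Hessian `2 Aᵀ A` of the smooth part. -/
def hess (A : Matrix (Fin m) (Fin n) ℝ) : Matrix (Fin n) (Fin n) ℝ := (2 : ℝ) • (Aᵀ * A)

lemma fidelityGrad_add (A : Matrix (Fin m) (Fin n) ℝ) (y : EuclideanSpace ℝ (Fin m))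
    (x h : EuclideanSpace ℝ (Fin n)) :
    fidelityGrad A y (x + h) = fidelityGrad A y x + hess A *ᵥ h.ofLp := by
  simp only [fidelityGrad, hess, WithLp.ofLp_add, Matrix.mulVec_add, Matrix.mulVec_sub,
    Matrix.smul_mulVec, ← Matrix.mulVec_mulVec]
  rw [← smul_add]; congr 1; abel

lemma continuous_fidelityGrad (A : Matrix (Fin m) (Fin n) ℝ) (y : EuclideanSpace ℝ (Fin m)) :
    Continuous (fidelityGrad A y) := by
  unfold fidelityGrad
  fun_prop

lemma fidelity_add (A : Matrix (Fin m) (Fin n) ℝ) (y : EuclideanSpace ℝ (Fin m))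
    (x h : EuclideanSpace ℝ (Fin n)) :
    ‖WithLp.toLp 2 (A *ᵥ (x + h).ofLp) - y‖ ^ 2 = ‖WithLp.toLp 2 (A *ᵥ x.ofLp) - y‖ ^ 2
      + ∑ i, fidelityGrad A y x i * h i + ‖WithLp.toLp 2 (A *ᵥ h.ofLp)‖ ^ 2 := by
  have h1 : WithLp.toLp 2 (A *ᵥ (x + h).ofLp) - y
      = (WithLp.toLp 2 (A *ᵥ x.ofLp) - y) + WithLp.toLp 2 (A *ᵥ h.ofLp) := by
    ext i; simp [Matrix.mulVec_add]; ring
  have h2 : ∑ i, fidelityGrad A y x i * h i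
      = 2 * inner ℝ (WithLp.toLp 2 (A *ᵥ x.ofLp) - y) (WithLp.toLp 2 (A *ᵥ h.ofLp)) := by
    have e1 : ∑ i, fidelityGrad A y x i * h i
        = (2 : ℝ) * ((Aᵀ *ᵥ (A *ᵥ x.ofLp - y.ofLp)) ⬝ᵥ h.ofLp) := by
      simp [fidelityGrad, dotProduct, Finset.mul_sum, mul_assoc]
    rw [e1, Matrix.mulVec_transpose, ← Matrix.dotProduct_mulVec]
    simp [PiLp.inner_apply, dotProduct, mul_comm]
  rw [h1, norm_add_sq_real, h2]

/-- The increment is exact: a separable sum plus a nonnegative quadratic remainder, the only term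
coupling coordinates. -/
lemma objective_add (A : Matrix (Fin m) (Fin n) ℝ) (y : EuclideanSpace ℝ (Fin m))
    (α p : ℝ) (w : Fin n → ℝ) (x h : EuclideanSpace ℝ (Fin n)) :
    objective A y α p w (x + h) - objective A y α p w x =
      ∑ i, (fidelityGrad A y x i * h i + (α * w i * absPow p (x i + h i)
        - α * w i * absPow p (x i))) + ‖WithLp.toLp 2 (A *ᵥ h.ofLp)‖ ^ 2 := by
  unfold objective
  rw [fidelity_add]
  simp only [Finset.sum_add_distrib, Finset.sum_sub_distrib, Finset.mul_sum, PiLp.add_apply,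
    mul_assoc]
  ring

/-- Multiplying the quotient by the norm removes the extended reals, and the base point, where the
inequality is trivial, can be added to the punctured neighbourhood. -/
lemma mem_regularSubdiff_iff {q : EuclideanSpace ℝ (Fin n) → ℝ}
    {x s : EuclideanSpace ℝ (Fin n)} :
    s ∈ regularSubdiff q x ↔ ∀ ε > 0, ∀ᶠ h in 𝓝 (0 : EuclideanSpace ℝ (Fin n)),
      -(ε * ‖h‖) ≤ q (x + h) - q x - inner ℝ s h := by
  have key : s ∈ regularSubdiff q x ↔ ∀ ε > 0, ∀ᶠ z in 𝓝 x,
      -(ε * ‖z - x‖) ≤ q z - q x - inner ℝ s (z - x) := by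
    unfold regularSubdiff
    rw [Set.mem_ofPred_eq, Filter.le_liminf_iff]
    constructor
    · intro H ε hε
      have h1 := H (((-ε : ℝ)) : EReal) (by exact_mod_cast neg_lt_zero.2 hε)
      rw [eventually_nhdsWithin_iff] at h1
      filter_upwards [h1] with z hz
      by_cases hzx : z = x
      · simp [hzx]
      · have h2 := hz hzx
        have h3 : 0 < ‖z - x‖ := norm_pos_iff.2 (sub_ne_zero.2 hzx)
        rw [EReal.coe_lt_coe_iff, lt_div_iff₀ h3] at h2
        linarith
    · intro H b hb
      obtain ⟨r, hr1, hr2⟩ := EReal.lt_iff_exists_real_btwn.1 hb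
      have hr3 : r < 0 := by exact_mod_cast hr2
      -- Halving `r` produces the strict inequality, since `r < r / 2` for negative `r`.
      filter_upwards [(H (-r / 2) (by linarith)).filter_mono nhdsWithin_le_nhds,
        self_mem_nhdsWithin] with z hz hzx
      refine hr1.trans ?_
      have h3 : 0 < ‖z - x‖ := norm_pos_iff.2 (sub_ne_zero.2 hzx)
      rw [EReal.coe_lt_coe_iff, lt_div_iff₀ h3]
      nlinarith
  rw [key]
  refine forall₂_congr fun ε _ => ?_
  constructor
  · intro H
    have : Tendsto (fun h => x + h) (𝓝 0) (𝓝 x) := by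
      simpa using (continuous_const_add x).tendsto 0
    simpa using this.eventually H
  · intro H
    have : Tendsto (fun z => z - x) (𝓝 x) (𝓝 0) := by
      simpa using (tendsto_id (x := 𝓝 x)).sub_const x
    simpa using this.eventually H

/-- The explicit form of the subdifferential of the objective. -/
def objectiveSubdiff (A : Matrix (Fin m) (Fin n) ℝ) (y : EuclideanSpace ℝ (Fin m))
    (α p : ℝ) (w : Fin n → ℝ) (x : EuclideanSpace ℝ (Fin n)) : Set (EuclideanSpace ℝ (Fin n)) :=
  {s | ∀ i, s i - fidelityGrad A y x i ∈ powSubdiff (α * w i) p (x i)}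

variable {A : Matrix (Fin m) (Fin n) ℝ} {y : EuclideanSpace ℝ (Fin m)} {α p : ℝ} {w : Fin n → ℝ}

/-- Increments along the axes give the coordinate conditions, the quadratic remainder being
`o(|h|)`. Conversely, the coordinate inequalities are summed and the remainder, being nonnegative,
is dropped. -/
lemma regularSubdiff_objective (hα : 0 < α) (hp₁ : p ≤ 1) (hw : ∀ i, 0 < w i)
    (x : EuclideanSpace ℝ (Fin n)) :
    regularSubdiff (objective A y α p w) x = objectiveSubdiff A y α p w x := by
  ext s
  rw [mem_regularSubdiff_iff]
  simp only [objective_add]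
  constructor
  · intro H i
    rw [mem_powSubdiff_iff (mul_pos hα (hw i)) hp₁]
    intro ε hε
    have hlin : Tendsto (fun h : ℝ => EuclideanSpace.single i h) (𝓝 0)
        (𝓝 (0 : EuclideanSpace ℝ (Fin n))) := by
      have h0 : (fun h : ℝ => EuclideanSpace.single i h)
          = fun h : ℝ => h • EuclideanSpace.single i (1 : ℝ) := by
        ext h j; simp
      rw [h0]
      simpa using (tendsto_id (x := 𝓝 (0 : ℝ))).smul_const (EuclideanSpace.single i (1 : ℝ))
    set C := ‖WithLp.toLp 2 (A *ᵥ (EuclideanSpace.single i (1 : ℝ)).ofLp)‖ ^ 2 with hC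
    have hC0 : 0 ≤ C := by positivity
    have hsm : ∀ᶠ h : ℝ in 𝓝 0, C * |h| < ε / 2 := by
      have : Tendsto (fun h : ℝ => C * |h|) (𝓝 0) (𝓝 0) := by
        simpa using (continuous_abs.tendsto (0 : ℝ)).const_mul C
      exact this.eventually_lt_const (by positivity)
    filter_upwards [hlin.eventually (H (ε / 2) (by positivity)), hsm] with h hh hs
    have hN : ‖WithLp.toLp 2 (A *ᵥ (EuclideanSpace.single i h).ofLp)‖ ^ 2 = C * |h| * |h| := by
      have : WithLp.toLp 2 (A *ᵥ (EuclideanSpace.single i h).ofLp)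
          = h • WithLp.toLp 2 (A *ᵥ (EuclideanSpace.single i (1 : ℝ)).ofLp) := by
        ext j; simp [mul_comm]
      rw [this, norm_smul, mul_pow, hC, Real.norm_eq_abs]; ring
    rw [hN, Finset.sum_eq_single i] at hh
    · simp only [PiLp.norm_single, Real.norm_eq_abs,
        EuclideanSpace.inner_single_right, PiLp.single_apply, if_true] at hh
      simp at hh
      nlinarith [abs_nonneg h]
    · intro j _ hj
      simp [hj]
    · simp
  · intro H ε hε
    -- The error is shared out as `ε / (n + 1)`, which also makes sense for `n = 0`.
    have hn : (0 : ℝ) < n + 1 := by positivity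
    have h1 : ∀ i, ∀ᶠ h : EuclideanSpace ℝ (Fin n) in 𝓝 0,
        -(ε / (n + 1) * |h i|) ≤ α * w i * absPow p (x i + h i) - α * w i * absPow p (x i)
          - (s i - fidelityGrad A y x i) * h i := fun i => by
      have hcont : Tendsto (fun h : EuclideanSpace ℝ (Fin n) => h i) (𝓝 0) (𝓝 0) := by
        have : Continuous (fun h : EuclideanSpace ℝ (Fin n) => h i) := by fun_prop
        simpa using this.tendsto 0
      exact hcont.eventually
        ((mem_powSubdiff_iff (mul_pos hα (hw i)) hp₁).1 (H i) (ε / (n + 1)) (by positivity))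
    filter_upwards [eventually_all.2 h1] with h hh
    have h2 := Finset.sum_le_sum fun i (_ : i ∈ Finset.univ) => hh i
    have h3 : ∑ i : Fin n, -(ε / (n + 1) * ‖h‖) ≤ ∑ i, -(ε / (n + 1) * |h i|) := by
      refine Finset.sum_le_sum fun i _ => neg_le_neg ?_
      exact mul_le_mul_of_nonneg_left (PiLp.norm_apply_le h i) (by positivity)
    have h4 : -(ε * ‖h‖) ≤ ∑ i : Fin n, -(ε / (n + 1) * ‖h‖) := by
      simp only [Finset.sum_const, Finset.card_univ, Fintype.card_fin, nsmul_eq_mul]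
      have : (n : ℝ) * (ε / (n + 1)) ≤ ε := by
        rw [← mul_div_assoc, div_le_iff₀ hn]; nlinarith
      nlinarith [norm_nonneg h]
    have h5 : (inner ℝ s h : ℝ) = ∑ i, s i * h i := by
      simp [PiLp.inner_apply, mul_comm]
    have h6 : 0 ≤ ‖WithLp.toLp 2 (A *ᵥ h.ofLp)‖ ^ 2 := by positivity
    have h7 : ∑ i, (α * w i * absPow p (x i + h i) - α * w i * absPow p (x i)
          - (s i - fidelityGrad A y x i) * h i)
        = ∑ i, (fidelityGrad A y x i * h i + (α * w i * absPow p (x i + h i)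
        - α * w i * absPow p (x i))) - ∑ i, s i * h i := by
      rw [← Finset.sum_sub_distrib]
      exact Finset.sum_congr rfl fun i _ => by ring
    linarith

/-- Regular subgradients already have a closed graph, so passing to limits adds nothing. -/
lemma limitingSubdiff_objective (hα : 0 < α) (hp₁ : p ≤ 1) (hw : ∀ i, 0 < w i) :
    limitingSubdiff (objective A y α p w) = objectiveSubdiff A y α p w := by
  funext x
  ext s
  constructor
  · rintro ⟨X, σ, hX, hσ, h, -⟩ i
    simp only [regularSubdiff_objective hα hp₁ hw] at h
    have c : ∀ i, Continuous (fun h : EuclideanSpace ℝ (Fin n) => h i) := fun i => by fun_prop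
    refine powSubdiff_closed (l := atTop) (mul_pos hα (hw i)).le (((c i).tendsto x).comp hX)
      ((((c i).tendsto s).comp hσ).sub
        ((((continuous_apply i).comp (continuous_fidelityGrad A y)).tendsto x).comp hX))
      (fun k => h k i)
  · intro h
    refine ⟨fun _ => x, fun _ => s, tendsto_const_nhds, tendsto_const_nhds, fun _ => ?_,
      tendsto_const_nhds⟩
    rwa [regularSubdiff_objective hα hp₁ hw]

lemma zero_mem_limitingSubdiff_of_isMinOn {q : EuclideanSpace ℝ (Fin n) → ℝ}
    {v : EuclideanSpace ℝ (Fin n)} (hv : IsMinOn q Set.univ v) : 0 ∈ limitingSubdiff q v := by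
  refine ⟨fun _ => v, fun _ => 0, tendsto_const_nhds, tendsto_const_nhds, fun _ => ?_,
      tendsto_const_nhds⟩
  refine mem_regularSubdiff_iff.2 fun ε hε => Eventually.of_forall fun h => ?_
  have h1 : q v ≤ q (v + h) := hv (Set.mem_univ _)
  have h2 : 0 ≤ ε * ‖h‖ := by positivity
  simp
  linarith

end SCD

namespace SCD

/-! ### Tangent spaces to the graph of the subdifferential -/

variable {m n : ℕ}

lemma mem_bouligandCone_of_eventually {F : Type*} [NormedAddCommGroup F] [NormedSpace ℝ F]
    {Ω : Set F} {x v : F} {U : ℝ → F} (hU : Tendsto U (𝓝[>] 0) (𝓝 v))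
    (h : ∀ᶠ t in 𝓝[>] (0 : ℝ), x + t • U t ∈ Ω) : v ∈ bouligandCone Ω x := by
  have h1 : Tendsto (fun k : ℕ => 1 / ((k : ℝ) + 1)) atTop (𝓝[>] 0) :=
    tendsto_nhdsWithin_iff.2 ⟨tendsto_one_div_add_atTop_nhds_zero_nat,
      Eventually.of_forall fun k => Set.mem_Ioi.2 (by positivity)⟩
  obtain ⟨N, hN⟩ := eventually_atTop.1 (h1.eventually h)
  have h2 := h1.comp (tendsto_add_atTop_nat N)
  refine ⟨_, _, fun k => ?_, h2.mono_right nhdsWithin_le_nhds, hU.comp h2,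
    fun k => hN (k + N) (Nat.le_add_left _ _)⟩
  simp only [Function.comp]
  positivity

/-- The subspace of all `(u, ζ)` with `u i = 0` off `I` and
`ζ i = (2 Aᵀ A u) i + α w i p (p - 1) |x i|^(p - 2) u i` on `I`. -/
def tangentSpace (A : Matrix (Fin m) (Fin n) ℝ) (α p : ℝ) (w : Fin n → ℝ)
    (x : EuclideanSpace ℝ (Fin n)) (I : Finset (Fin n)) : Submodule ℝ (PairSpace n) where
  carrier := {z | (∀ i ∈ I, z.snd i - (hess A *ᵥ z.fst.ofLp) i
    = powCurvature (α * w i) p (x i) * z.fst i) ∧ ∀ i ∉ I, z.fst i = 0}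
  add_mem' := by
    rintro a b ⟨ha, ha'⟩ ⟨hb, hb'⟩
    refine ⟨fun i hi => ?_, fun i hi => ?_⟩
    · have h1 := ha i hi
      have h2 := hb i hi
      simp only [WithLp.add_fst, WithLp.add_snd, WithLp.ofLp_add, Matrix.mulVec_add, Pi.add_apply]
      linear_combination h1 + h2
    · simp [ha' i hi, hb' i hi]
  zero_mem' := by simp
  smul_mem' := by
    rintro c a ⟨ha, ha'⟩
    refine ⟨fun i hi => ?_, fun i hi => ?_⟩
    · have h1 := ha i hi
      simp only [WithLp.smul_fst, WithLp.smul_snd, WithLp.ofLp_smul, Matrix.mulVec_smul,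
        Pi.smul_apply, smul_eq_mul]
      linear_combination c * h1
    · simp [ha' i hi]

variable {A : Matrix (Fin m) (Fin n) ℝ} {y : EuclideanSpace ℝ (Fin m)} {α p : ℝ} {w : Fin n → ℝ}

lemma mem_tangentSpace {x : EuclideanSpace ℝ (Fin n)} {I : Finset (Fin n)} {z : PairSpace n} :
    z ∈ tangentSpace A α p w x I ↔ (∀ i ∈ I, z.snd i - (hess A *ᵥ z.fst.ofLp) i
      = powCurvature (α * w i) p (x i) * z.fst i) ∧ ∀ i ∉ I, z.fst i = 0 := Iff.rfl

/-- The entries of the first component on `I` and of the second off `I` are free coordinates; the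
equations determine the rest. -/
lemma finrank_tangentSpace (x : EuclideanSpace ℝ (Fin n)) (I : Finset (Fin n)) :
    Module.finrank ℝ (tangentSpace A α p w x I) = n := by
  let f : tangentSpace A α p w x I →ₗ[ℝ] (Fin n → ℝ) :=
    { toFun := fun z i => if i ∈ I then z.1.fst i else z.1.snd i
      map_add' := fun a b => by ext i; by_cases hi : i ∈ I <;> simp [hi]
      map_smul' := fun c a => by ext i; by_cases hi : i ∈ I <;> simp [hi] }
  have hinj : Function.Injective f := by
    rw [injective_iff_map_eq_zero]
    rintro ⟨z, hz1, hz2⟩ h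
    have h1 : z.fst = 0 := by
      ext i
      by_cases hi : i ∈ I
      · simpa [f, hi] using congrFun h i
      · exact hz2 i hi
    have h2 : z.snd = 0 := by
      ext i
      by_cases hi : i ∈ I
      · simpa [h1] using hz1 i hi
      · simpa [f, hi] using congrFun h i
    have h3 : z = 0 := by
      rw [← WithLp.toLp_ofLp 2 z]
      exact congrArg (WithLp.toLp 2) (Prod.ext h1 h2)
    exact Subtype.ext h3
  have hsurj : Function.Surjective f := by
    intro a
    let u : EuclideanSpace ℝ (Fin n) := WithLp.toLp 2 fun i => if i ∈ I then a i else 0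
    let ζ : EuclideanSpace ℝ (Fin n) := WithLp.toLp 2 fun i =>
      if i ∈ I then (hess A *ᵥ u.ofLp) i + powCurvature (α * w i) p (x i) * u i else a i
    refine ⟨⟨WithLp.toLp 2 (u, ζ), fun i hi => ?_, fun i hi => ?_⟩, ?_⟩
    · simp [ζ, hi]
    · simp [u, hi]
    · ext i
      by_cases hi : i ∈ I <;> simp [f, u, ζ, hi]
  simpa using (LinearEquiv.ofBijective f ⟨hinj, hsurj⟩).finrank_eq

/-- Because the gradient is affine, the shear `(u, ζ) ↦ (u, ζ - 2 Aᵀ A u)` decouples the graph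
exactly, with no error term in `t`. -/
lemma mem_graph_add_iff {z U : PairSpace n} {t : ℝ} :
    z + t • U ∈ graph (objectiveSubdiff A y α p w) ↔ ∀ i,
      (z.snd i - fidelityGrad A y z.fst i) + t * (U.snd i - (hess A *ᵥ U.fst.ofLp) i)
        ∈ powSubdiff (α * w i) p (z.fst i + t * U.fst i) := by
  unfold graph objectiveSubdiff
  simp only [Set.mem_ofPred_eq, WithLp.add_fst, WithLp.add_snd, WithLp.smul_fst, WithLp.smul_snd,
    fidelityGrad_add, WithLp.ofLp_smul, Matrix.mulVec_smul, Pi.add_apply, Pi.smul_apply,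
    smul_eq_mul, PiLp.add_apply, PiLp.smul_apply]
  refine forall_congr' fun i => ?_
  rw [show z.snd i + t * U.snd i - (fidelityGrad A y z.fst i + t * (hess A *ᵥ U.fst.ofLp) i)
    = (z.snd i - fidelityGrad A y z.fst i) + t * (U.snd i - (hess A *ᵥ U.fst.ofLp) i) by ring]

lemma continuous_pair_fst (i : Fin n) : Continuous fun z : PairSpace n => z.fst i := by fun_prop

lemma continuous_pair_sheared (A : Matrix (Fin m) (Fin n) ℝ) (i : Fin n) :
    Continuous fun z : PairSpace n => z.snd i - (hess A *ᵥ z.fst.ofLp) i := by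
  have : Continuous fun z : PairSpace n => hess A *ᵥ z.fst.ofLp :=
    continuous_const.matrix_mulVec (by fun_prop)
  exact Continuous.sub (by fun_prop) ((continuous_apply i).comp this)

lemma coordinates_of_mem_bouligandCone {z u : PairSpace n}
    (hu : u ∈ bouligandCone (graph (objectiveSubdiff A y α p w)) z) (i : Fin n) :
    ∃ t a b : ℕ → ℝ, (∀ k, 0 < t k) ∧ Tendsto t atTop (𝓝 0) ∧ Tendsto a atTop (𝓝 (u.fst i)) ∧
      Tendsto b atTop (𝓝 (u.snd i - (hess A *ᵥ u.fst.ofLp) i)) ∧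
      ∀ k, (z.snd i - fidelityGrad A y z.fst i) + t k * b k
        ∈ powSubdiff (α * w i) p (z.fst i + t k * a k) := by
  obtain ⟨t, U, ht, ht0, hU, h⟩ := hu
  exact ⟨t, _, _, ht, ht0, ((continuous_pair_fst i).tendsto u).comp hU,
    ((continuous_pair_sheared A i).tendsto u).comp hU, fun k => mem_graph_add_iff.1 (h k) i⟩

/-- Tangent spaces at points of graphical smoothness. -/
lemma tangent_le_tangentSpace (hα : 0 < α) (hp₀ : 0 ≤ p) (hp₁ : p ≤ 1) (hw : ∀ i, 0 < w i)
    {z : PairSpace n} {T : Submodule ℝ (PairSpace n)}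
    (hT : IsGraphTangentSpace (objectiveSubdiff A y α p w) z T) :
    T ≤ tangentSpace A α p w z.fst (lowerIndexSet z.fst) := by
  obtain ⟨hz, -, hc⟩ := hT
  have hmem : ∀ u, u ∈ T ↔ u ∈ bouligandCone (graph (objectiveSubdiff A y α p w)) z := fun u => by
    rw [hc]; rfl
  intro u hu
  rw [mem_tangentSpace]
  simp only [lowerIndexSet, Finset.mem_filter, Finset.mem_univ, true_and, not_not]
  constructor
  · intro i hi
    obtain ⟨t, a, b, ht, ht0, ha, hb, h⟩ := coordinates_of_mem_bouligandCone ((hmem u).1 hu) i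
    exact powCurvature_tangent ht ht0 ha hb (hz i) h hi
  · intro i hi
    have hci := mul_pos hα (hw i)
    by_contra hne
    obtain ⟨t, a, b, ht, ht0, ha, hb, h⟩ := coordinates_of_mem_bouligandCone ((hmem u).1 hu) i
    rw [hi] at h
    rcases hp₀.eq_or_lt with h0 | h0
    · subst h0
      obtain ⟨hs, -⟩ := tangent_zero ht ht0 ha hb h hne
      -- At a crossing both axis directions are tangent: the horizontal one is `(e, d)` after
      -- undoing the shear, the vertical one is `(0, e)`. Their sum is not tangent, so the cone is
      -- not a subspace.
      set e : EuclideanSpace ℝ (Fin n) := EuclideanSpace.single i 1 with he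
      set d : EuclideanSpace ℝ (Fin n) := WithLp.toLp 2 (hess A *ᵥ e.ofLp) with hd
      have m1 : (WithLp.toLp 2 (e, d) : PairSpace n) ∈ T := by
        rw [hmem]
        refine mem_bouligandCone_of_eventually tendsto_const_nhds
          (Eventually.of_forall fun t => mem_graph_add_iff.2 fun j => ?_)
        by_cases hj : j = i
        · subst hj
          simp [hd, hs, powSubdiff]
        · simpa [hd, he, hj] using hz j
      have m2 : (WithLp.toLp 2 (0, e) : PairSpace n) ∈ T := by
        rw [hmem]
        refine mem_bouligandCone_of_eventually tendsto_const_nhds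
          (Eventually.of_forall fun t => mem_graph_add_iff.2 fun j => ?_)
        by_cases hj : j = i
        · subst hj
          simp [hi, powSubdiff]
        · simpa [he, hj] using hz j
      obtain ⟨t, a, b, ht, ht0, ha, hb, h⟩ :=
        coordinates_of_mem_bouligandCone ((hmem _).1 (T.add_mem m1 m2)) i
      rw [hi] at h
      have := (tangent_zero ht ht0 ha hb h (by simp [he])).2
      simp [hd, he] at this
    · rcases hp₁.eq_or_lt with h1 | h1
      · subst h1
        -- A subspace contains `-u` as well, so the point would be both the upper and the lower
        -- corner.
        obtain ⟨t', a', b', ht', ht0', ha', hb', h'⟩ :=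
          coordinates_of_mem_bouligandCone ((hmem _).1 (T.neg_mem hu)) i
        rw [hi] at h'
        have e1 := tangent_one ht ht0 ha hb h
        have e2 := tangent_one ht' ht0' ha' hb' h'
        simp only [WithLp.neg_fst, PiLp.neg_apply, Left.neg_pos_iff, Left.neg_neg_iff] at e2
        rcases lt_or_gt_of_ne hne with hlt | hlt
        · have := e1.2 hlt; have := e2.1 hlt; linarith
        · have := e1.1 hlt; have := e2.2 hlt; linarith
      · exact hne (tangent_eq_zero_of_lt_one hci h0 h1 ht ht0 ha hb h)

/-- Points of the graph with `p = 1` away from the corners and `p = 0` away from the crossings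
are points of graphical smoothness. -/
lemma isGraphTangentSpace_tangentSpace (hα : 0 < α) (hp₀ : 0 ≤ p) (hp₁ : p ≤ 1)
    (hw : ∀ i, 0 < w i) {z : PairSpace n}
    (hz : ∀ i, z.snd i - fidelityGrad A y z.fst i ∈ powSubdiff (α * w i) p (z.fst i))
    (h1 : ∀ i, z.fst i = 0 → p = 1 → |z.snd i - fidelityGrad A y z.fst i| < α * w i)
    (h0 : ∀ i, z.fst i = 0 → p = 0 → z.snd i - fidelityGrad A y z.fst i ≠ 0) :
    IsGraphTangentSpace (objectiveSubdiff A y α p w) z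
      (tangentSpace A α p w z.fst (lowerIndexSet z.fst)) := by
  refine ⟨hz, finrank_tangentSpace _ _, Set.Subset.antisymm (fun u hu => ?_) (fun u hu => ?_)⟩
  · rw [SetLike.mem_coe, mem_tangentSpace]
    simp only [lowerIndexSet, Finset.mem_filter, Finset.mem_univ, true_and, not_not]
    constructor
    · intro i hi
      obtain ⟨t, a, b, ht, ht0, ha, hb, h⟩ := coordinates_of_mem_bouligandCone hu i
      exact powCurvature_tangent ht ht0 ha hb (hz i) h hi
    · intro i hi
      have hci := mul_pos hα (hw i)
      by_contra hne
      obtain ⟨t, a, b, ht, ht0, ha, hb, h⟩ := coordinates_of_mem_bouligandCone hu i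
      rw [hi] at h
      rcases hp₀.eq_or_lt with hp | hp
      · subst hp
        exact h0 i hi rfl (tangent_zero ht ht0 ha hb h hne).1
      · rcases hp₁.eq_or_lt with hp' | hp'
        · subst hp'
          have e1 := tangent_one ht ht0 ha hb h
          have e2 := h1 i hi rfl
          rcases lt_or_gt_of_ne hne with hlt | hlt
          · rw [e1.2 hlt, abs_neg, abs_of_pos hci] at e2; exact lt_irrefl _ e2
          · rw [e1.1 hlt, abs_of_pos hci] at e2; exact lt_irrefl _ e2
        · exact hne (tangent_eq_zero_of_lt_one hci hp hp' ht ht0 ha hb h)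
  · rw [SetLike.mem_coe, mem_tangentSpace] at hu
    simp only [lowerIndexSet, Finset.mem_filter, Finset.mem_univ, true_and, not_not] at hu
    obtain ⟨hu1, hu2⟩ := hu
    -- The difference quotient of the slope replaces its derivative on the support, so that `z + t •
    -- (u.fst, ζ t)` stays on the graph for small `t > 0`.
    let ζ : ℝ → EuclideanSpace ℝ (Fin n) := fun t => WithLp.toLp 2 fun i =>
      if z.fst i = 0 then u.snd i else (hess A *ᵥ u.fst.ofLp) i +
        t⁻¹ * (powSlope (α * w i) p (z.fst i + t * u.fst i) - powSlope (α * w i) p (z.fst i))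
    have hζ : Tendsto ζ (𝓝[>] 0) (𝓝 u.snd) := by
      refine ((PiLp.continuous_toLp 2 _).tendsto u.snd.ofLp).comp (tendsto_pi_nhds.2 fun i => ?_)
      by_cases hi : z.fst i = 0
      · simp only [hi, if_true]; exact tendsto_const_nhds
      · simp only [hi, if_false]
        have hid : Tendsto (fun t : ℝ => t) (𝓝[>] 0) (𝓝 0) := nhdsWithin_le_nhds
        have hd := (hasFDerivWithinAt_univ.2
          (hasDerivAt_powSlope (α * w i) p hi).hasFDerivAt).lim (c := fun t : ℝ => t⁻¹)
          (d := fun t => t * u.fst i) (v := u.fst i) (l := 𝓝[>] 0)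
          (by simpa using hid.mul_const (u.fst i)) (Eventually.of_forall fun _ => trivial)
          (tendsto_const_nhds.congr' (by
            filter_upwards [self_mem_nhdsWithin] with t ht
            have : t ≠ 0 := (Set.mem_Ioi.1 ht).ne'
            simp [this]))
        have hd2 := hd.const_add ((hess A *ᵥ u.fst.ofLp) i)
        have := hu1 i hi
        rw [ContinuousLinearMap.toSpanSingleton_apply, smul_eq_mul, mul_comm (u.fst i), ← this,
          add_sub_cancel] at hd2
        exact hd2
    have hU : Tendsto (fun t => (WithLp.toLp 2 (u.fst, ζ t) : PairSpace n)) (𝓝[>] 0) (𝓝 u) :=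
      ((WithLp.prod_continuous_toLp 2 _ _).tendsto (u.fst, u.snd)).comp
        (tendsto_const_nhds.prodMk_nhds hζ)
    refine mem_bouligandCone_of_eventually hU ?_
    simp only [mem_graph_add_iff]
    refine eventually_all.2 fun i => ?_
    by_cases hi : z.fst i = 0
    · have hcl : ∀ b : ℝ, Tendsto (fun t : ℝ => (z.snd i - fidelityGrad A y z.fst i) + t * b)
          (𝓝[>] 0) (𝓝 (z.snd i - fidelityGrad A y z.fst i)) := fun b => by
        have hid : Tendsto (fun t : ℝ => t) (𝓝[>] 0) (𝓝 0) := nhdsWithin_le_nhds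
        simpa using (hid.mul_const b).const_add (z.snd i - fidelityGrad A y z.fst i)
      by_cases hp : p = 1
      · filter_upwards [(hcl (u.snd i - (hess A *ᵥ u.fst.ofLp) i)).abs.eventually_lt_const
          (h1 i hi hp)] with t ht
        refine ⟨fun h => absurd ?_ h, fun _ _ => ?_⟩
        · simp [hi, hu2 i hi]
        · simpa [ζ, hi] using ht.le
      · refine Eventually.of_forall fun t => ⟨fun h => absurd ?_ h, fun _ h => absurd h hp⟩
        simp [hi, hu2 i hi]
    · have hcl : Tendsto (fun t : ℝ => z.fst i + t * u.fst i) (𝓝[>] 0) (𝓝 (z.fst i)) := by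
        have hid : Tendsto (fun t : ℝ => t) (𝓝[>] 0) (𝓝 0) := nhdsWithin_le_nhds
        simpa using (hid.mul_const (u.fst i)).const_add (z.fst i)
      filter_upwards [hcl.eventually_ne hi, self_mem_nhdsWithin] with t ht ht0
      have ht1 : t ≠ 0 := (Set.mem_Ioi.1 ht0).ne'
      refine ⟨fun _ => ?_, fun h => absurd h ht⟩
      rw [(hz i).1 hi]
      simp [ζ, hi, ht1]

end SCD

namespace SCD


variable {m n : ℕ}

/-! ### The matrices -/

lemma isUnit_matrix_iff {ι : Type*} [Fintype ι] [DecidableEq ι] (M : Matrix ι ι ℝ) :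
    IsUnit M ↔ ∀ u : ι → ℝ, M *ᵥ u = 0 → u = 0 := by
  rw [← Matrix.mulVec_injective_iff_isUnit]
  exact injective_iff_map_eq_zero M.mulVecLin

lemma matP_mulVec (I : Finset (Fin n)) (u : Fin n → ℝ) :
    matP I *ᵥ u = fun i => if i ∈ I then u i else 0 := by
  ext i
  simp [matP, Matrix.mulVec_diagonal]

lemma matW_mulVec (α p : ℝ) (w : Fin n → ℝ) (v : EuclideanSpace ℝ (Fin n)) (I : Finset (Fin n))
    (u : Fin n → ℝ) (i : Fin n) : (matW α p w v I *ᵥ u) i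
      = if i ∈ I then powCurvature (α * w i) p (v i) * u i else u i := by
  rw [matW, Matrix.mulVec_diagonal]
  by_cases hi : i ∈ I
  · rcases em (p = 0) with rfl | h0
    · simp [hi, powCurvature]
    rcases em (p = 1) with rfl | h1
    · simp [hi, powCurvature]
    simp [hi, h0, h1, powCurvature]
  · simp [hi]

/-- Rows off `I` force `u` to be supported in `I`, after which the right-hand projection acts
trivially. For `v` as base point the result says that `(u, 0)` lies in `tangentSpace`. -/
lemma reduced_mulVec_eq_zero_iff (A : Matrix (Fin m) (Fin n) ℝ) (α p : ℝ) (w : Fin n → ℝ)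
    (v : EuclideanSpace ℝ (Fin n)) (I : Finset (Fin n)) (u : Fin n → ℝ) :
    ((2 : ℝ) • (matP I * Aᵀ * A * matP I) + matW α p w v I) *ᵥ u = 0 ↔
      (∀ i ∈ I, (hess A *ᵥ u) i + powCurvature (α * w i) p (v i) * u i = 0) ∧
        ∀ i ∉ I, u i = 0 := by
  have key : ∀ i, (((2 : ℝ) • (matP I * Aᵀ * A * matP I) + matW α p w v I) *ᵥ u) i
      = if i ∈ I then (hess A *ᵥ (matP I *ᵥ u)) i + powCurvature (α * w i) p (v i) * u i
        else u i := by
    intro i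
    have e : (2 : ℝ) • (matP I * Aᵀ * A * matP I) *ᵥ u = matP I *ᵥ (hess A *ᵥ (matP I *ᵥ u)) := by
      simp only [hess, Matrix.mulVec_mulVec, Matrix.smul_mul, Matrix.smul_mulVec,
        Matrix.mulVec_smul, Matrix.mul_assoc]
    rw [Matrix.add_mulVec, Pi.add_apply, matW_mulVec, Matrix.smul_mulVec, e, matP_mulVec]
    by_cases hi : i ∈ I <;> simp [hi]
  have hP : (∀ i ∉ I, u i = 0) → matP I *ᵥ u = u := by
    intro h
    rw [matP_mulVec]
    ext i
    by_cases hi : i ∈ I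
    · simp [hi]
    · simp [hi, h i hi]
  rw [funext_iff]
  simp only [key, Pi.zero_apply]
  constructor
  · intro h
    have h2 : ∀ i ∉ I, u i = 0 := fun i hi => by simpa [hi] using h i
    refine ⟨fun i hi => ?_, h2⟩
    simpa [hi, hP h2] using h i
  · rintro ⟨h1, h2⟩ i
    by_cases hi : i ∈ I
    · simpa [hi, hP h2] using h1 i hi
    · simpa [hi] using h2 i hi

lemma hess_mulVec_extend (A : Matrix (Fin m) (Fin n) ℝ) (I : Finset (Fin n)) {u : Fin n → ℝ}
    (hu : ∀ i ∉ I, u i = 0) (i : I) :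
    (hess A *ᵥ u) i = 2 * (((colSubmatrix A I)ᵀ * colSubmatrix A I) *ᵥ fun j : I => u j) i := by
  rw [hess, Matrix.smul_mulVec, Pi.smul_apply, smul_eq_mul]
  congr 1
  simp only [Matrix.mulVec, dotProduct]
  rw [← Finset.sum_subset (Finset.subset_univ I), ← Finset.sum_coe_sort I]
  · rfl
  · intro j _ hj
    rw [hu j hj, mul_zero]

/-- The curvature vanishes for `p ∈ {0, 1}`, so extension by zero and restriction to `I` match the
two kernels. -/
lemma isUnit_reduced_iff_isUnit_gram (A : Matrix (Fin m) (Fin n) ℝ) (α : ℝ) {p : ℝ}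
    (hp : p = 0 ∨ p = 1) (w : Fin n → ℝ) (v : EuclideanSpace ℝ (Fin n)) (I : Finset (Fin n)) :
    IsUnit ((2 : ℝ) • (matP I * Aᵀ * A * matP I) + matW α p w v I) ↔
      IsUnit ((colSubmatrix A I)ᵀ * colSubmatrix A I) := by
  have hκ : ∀ i, powCurvature (α * w i) p (v i) = 0 := fun i => by
    rcases hp with rfl | rfl <;> simp [powCurvature]
  simp only [isUnit_matrix_iff, reduced_mulVec_eq_zero_iff, hκ, zero_mul, add_zero]
  constructor
  · intro H u hu
    let u' : Fin n → ℝ := fun i => if h : i ∈ I then u ⟨i, h⟩ else 0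
    have h0 : ∀ i ∉ I, u' i = 0 := fun i hi => by simp [u', hi]
    have hr : (fun j : I => u' j) = u := by ext j; simp [u']
    have := H u' ⟨fun i hi => ?_, h0⟩
    · rw [← hr, this]; rfl
    · rw [hess_mulVec_extend A I h0 ⟨i, hi⟩, hr, hu]; simp
  · rintro H u ⟨h1, h0⟩
    have h2 := H (fun j : I => u j) (by
      ext i
      have := hess_mulVec_extend A I h0 i
      rw [h1 i i.2] at this
      simpa using this.symm)
    ext i
    by_cases hi : i ∈ I
    · exact congrFun h2 ⟨i, hi⟩
    · exact h0 i hi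

/-! ### The SC derivative at a minimizer -/

variable {A : Matrix (Fin m) (Fin n) ℝ} {y : EuclideanSpace ℝ (Fin m)} {α p : ℝ} {w : Fin n → ℝ}

/-- Admissibility of an index whose coordinate is `v` and whose partial derivative is `r`. -/
def IsActive (c p v r : ℝ) : Prop := v ≠ 0 ∨ (p = 1 ∧ |r| = c) ∨ (p = 0 ∧ r = 0)

lemma mem_upperIndexSet_iff {r : Fin n → ℝ} {v : EuclideanSpace ℝ (Fin n)} {i : Fin n} :
    i ∈ upperIndexSet α p w r v ↔ IsActive (α * w i) p (v i) (r i) := by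
  unfold upperIndexSet lowerIndexSet IsActive
  by_cases hv : v i = 0
  · split_ifs with h1 h0
    · subst h1; simp [hv]
    · subst h0; simp [hv]
    · simp [hv, h1, h0]
  · simp [hv]

/-- Along nonzero `a k` tending to zero the slopes are `0` for `p = 0`, of modulus `c` for `p = 1`,
and divergent in between. -/
lemma isActive_of_tendsto {c p v r : ℝ} (hc : 0 < c) (hp₀ : 0 ≤ p) (hp₁ : p ≤ 1) {a b : ℕ → ℝ}
    (ha : Tendsto a atTop (𝓝 v)) (hb : Tendsto b atTop (𝓝 (-r)))
    (h : ∀ k, b k ∈ powSubdiff c p (a k)) (hne : ∀ k, a k ≠ 0) : IsActive c p v r := by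
  by_cases hv : v = 0
  · subst hv
    right
    have hb' : Tendsto (fun k => powSlope c p (a k)) atTop (𝓝 (-r)) :=
      hb.congr fun k => (h k).1 (hne k)
    rcases hp₀.eq_or_lt with h0 | h0
    · subst h0
      simp only [powSlope_zero] at hb'
      have := tendsto_nhds_unique hb' tendsto_const_nhds
      exact Or.inr ⟨rfl, by linarith⟩
    · rcases hp₁.eq_or_lt with h1 | h1
      · subst h1
        refine Or.inl ⟨rfl, ?_⟩
        have h2 := hb'.abs
        rw [abs_neg] at h2
        refine tendsto_nhds_unique h2 (tendsto_const_nhds.congr fun k => ?_)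
        have := abs_powSlope_mul (hne k) hc.le h0.le
        simpa using this.symm
      · exact absurd hb' (not_tendsto_powSlope hc h0 h1 ha (Eventually.of_forall hne))
  · exact Or.inl hv

/-- One-dimensional approximation by smooth points of the graph with nonzero base point. -/
lemma exists_approx_of_isActive {c p v r : ℝ} (hc : 0 < c) (hr : -r ∈ powSubdiff c p v)
    (h : IsActive c p v r) : ∃ a b : ℕ → ℝ, Tendsto a atTop (𝓝 v) ∧ Tendsto b atTop (𝓝 (-r)) ∧
      ∀ k, b k ∈ powSubdiff c p (a k) ∧ a k ≠ 0 ∧ powCurvature c p (a k) = powCurvature c p v := by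
  by_cases hv : v = 0
  · subst hv
    have hδ : Tendsto (fun k : ℕ => 1 / ((k : ℝ) + 1)) atTop (𝓝 0) :=
      tendsto_one_div_add_atTop_nhds_zero_nat
    have hδ0 : ∀ k : ℕ, 0 < 1 / ((k : ℝ) + 1) := fun k => by positivity
    rcases h with h | ⟨rfl, h⟩ | ⟨rfl, rfl⟩
    · exact absurd rfl h
    · have hr0 : r ≠ 0 := by rintro rfl; simp at h; linarith
      -- Points with the sign of `-r` have slope exactly `-r`, because `|r| = c`.
      refine ⟨fun k => 1 / ((k : ℝ) + 1) * (-r), fun _ => -r, by simpa using hδ.mul_const (-r),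
        tendsto_const_nhds, fun k => ?_⟩
      have hne : 1 / ((k : ℝ) + 1) * (-r) ≠ 0 := mul_ne_zero (hδ0 k).ne' (neg_ne_zero.2 hr0)
      refine ⟨⟨fun _ => ?_, fun h0 => absurd h0 hne⟩, hne, by simp [powCurvature]⟩
      rcases lt_or_gt_of_ne hr0 with h0 | h0
      · rw [powSlope_one_of_pos _ (mul_pos (hδ0 k) (neg_pos.2 h0)), ← h, abs_of_neg h0]
      · rw [powSlope_one_of_neg _ (mul_neg_of_pos_of_neg (hδ0 k) (neg_lt_zero.2 h0)), ← h,
          abs_of_pos h0]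
    · refine ⟨fun k => 1 / ((k : ℝ) + 1), fun _ => -0, hδ, tendsto_const_nhds, fun k => ?_⟩
      refine ⟨⟨fun _ => by simp, fun h0 => absurd h0 (hδ0 k).ne'⟩, (hδ0 k).ne',
        by simp [powCurvature]⟩
  · exact ⟨fun _ => v, fun _ => -r, tendsto_const_nhds, tendsto_const_nhds, fun k => ⟨hr, hv, rfl⟩⟩

/-- One-dimensional approximation by smooth points of the graph with base point zero. -/
lemma exists_approx_zero {c p r : ℝ} (hc : 0 < c) (hr : -r ∈ powSubdiff c p 0) :
    ∃ b : ℕ → ℝ, Tendsto b atTop (𝓝 (-r)) ∧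
      ∀ k, b k ∈ powSubdiff c p 0 ∧ (p = 1 → |b k| < c) ∧ (p = 0 → b k ≠ 0) := by
  have hδ : Tendsto (fun k : ℕ => 1 / ((k : ℝ) + 1)) atTop (𝓝 0) :=
    tendsto_one_div_add_atTop_nhds_zero_nat
  have hδ0 : ∀ k : ℕ, 0 < 1 / ((k : ℝ) + 1) := fun k => by positivity
  by_cases hp : p = 1
  · subst hp
    have hb : ∀ k : ℕ, |(-r) * (1 - 1 / ((k : ℝ) + 1))| < c := fun k => by
      have h1 : 1 / ((k : ℝ) + 1) ≤ 1 := by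
        rw [div_le_one (by positivity)]; linarith [(Nat.cast_nonneg k : (0 : ℝ) ≤ k)]
      have h2 := hr.2 rfl rfl
      rw [abs_mul, abs_of_nonneg (by linarith : 0 ≤ 1 - 1 / ((k : ℝ) + 1))]
      have h3 := hδ0 k
      have h4 := mul_le_mul_of_nonneg_right h2 (by linarith : 0 ≤ 1 - 1 / ((k : ℝ) + 1))
      nlinarith
    -- Shrinking towards zero moves a possible corner into the open segment.
    refine ⟨fun k => (-r) * (1 - 1 / ((k : ℝ) + 1)), by simpa using (hδ.const_sub 1).const_mul (-r),
      fun k => ⟨⟨fun h => absurd rfl h, fun _ _ => (hb k).le⟩, fun _ => hb k, fun h => ?_⟩⟩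
    norm_num at h
  · have hm : ∀ b : ℝ, b ∈ powSubdiff c p 0 := fun b =>
      ⟨fun h => absurd rfl h, fun _ h => absurd h hp⟩
    -- The case split keeps `b k` away from zero, hence off the crossing.
    rcases le_or_gt 0 r with h0 | h0
    · refine ⟨fun k => -r - 1 / ((k : ℝ) + 1), by simpa using hδ.const_sub (-r), fun k =>
        ⟨hm _, fun h => absurd h hp, fun _ => ?_⟩⟩
      have := hδ0 k
      exact (by linarith : -r - 1 / ((k : ℝ) + 1) < 0).ne
    · exact ⟨fun k => -r, tendsto_const_nhds, fun k => ⟨hm _, fun h => absurd h hp,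
        fun _ => (neg_pos.2 h0).ne'⟩⟩

/-- The limit `L` need not be identified: projecting `(s, 0)` onto the approximating tangent spaces
and passing to the limit in their equations puts `s` in the kernel of a reduced matrix. -/
lemma eq_zero_of_mem_scDerivative (hα : 0 < α) (hp₀ : 0 ≤ p) (hp₁ : p ≤ 1) (hw : ∀ i, 0 < w i)
    {v : EuclideanSpace ℝ (Fin n)}
    (H : ∀ I : Finset (Fin n), lowerIndexSet v ⊆ I →
      I ⊆ upperIndexSet α p w (fidelityGrad A y v) v →
      IsUnit ((2 : ℝ) • (matP I * Aᵀ * A * matP I) + matW α p w v I))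
    {L : Submodule ℝ (PairSpace n)} (hL : L ∈ scDerivative (objectiveSubdiff A y α p w) v 0)
    {s : EuclideanSpace ℝ (Fin n)} (hs : (WithLp.toLp 2 (s, 0) : PairSpace n) ∈ L) : s = 0 := by
  obtain ⟨-, z, T, hT, hz, hd⟩ := hL
  -- There are finitely many supports, so one recurs infinitely often and is constant along a
  -- subsequence.
  obtain ⟨I, hI⟩ : ∃ I, ∃ᶠ k in atTop, lowerIndexSet (z k).fst = I := by
    by_contra hcon
    push Not at hcon
    obtain ⟨k, hk⟩ := (eventually_all.2 hcon).exists
    exact hk _ rfl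
  obtain ⟨φ, hφ, hφI⟩ := extraction_of_frequently_atTop hI
  have hφt := hφ.tendsto_atTop
  have hzφ := hz.comp hφt
  have hx : ∀ i, Tendsto (fun k => (z (φ k)).fst i) atTop (𝓝 (v i)) := fun i =>
    ((continuous_pair_fst i).tendsto _).comp hzφ
  have hb : ∀ i, Tendsto (fun k => (z (φ k)).snd i - fidelityGrad A y (z (φ k)).fst i) atTop
      (𝓝 (-fidelityGrad A y v i)) := fun i => by
    have hc : Continuous fun z : PairSpace n => z.snd i - fidelityGrad A y z.fst i :=
      Continuous.sub (by fun_prop)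
        ((continuous_apply i).comp ((continuous_fidelityGrad A y).comp (by fun_prop)))
    have := (hc.tendsto _).comp hzφ
    simp only [WithLp.toLp_fst, WithLp.toLp_snd, PiLp.zero_apply, zero_sub] at this
    exact this
  have hmemI : ∀ k i, i ∈ I ↔ (z (φ k)).fst i ≠ 0 := fun k i => by
    rw [← hφI k]; simp [lowerIndexSet]
  have hact : ∀ i ∈ I, IsActive (α * w i) p (v i) (fidelityGrad A y v i) := fun i hi =>
    isActive_of_tendsto (mul_pos hα (hw i)) hp₀ hp₁ (hx i) (hb i)
      (fun k => (hT (φ k)).1 i) (fun k => (hmemI k i).1 hi)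
  have hunit := H I (fun i hi => ?_) (fun i hi => mem_upperIndexSet_iff.2 (hact i hi))
  · set ℓ : PairSpace n := WithLp.toLp 2 (s, 0) with hℓ
    have hproj : Tendsto (fun k => (T (φ k)).starProjection ℓ) atTop (𝓝 ℓ) := by
      rw [tendsto_iff_norm_sub_tendsto_zero]
      have h0 : Tendsto (fun k => distZ L (T (φ k)) * ‖ℓ‖) atTop (𝓝 0) := by
        simpa using (hd.comp hφt).mul_const ‖ℓ‖
      refine squeeze_zero (fun _ => norm_nonneg _) (fun k => ?_) h0
      have h1 : L.starProjection ℓ = ℓ := Submodule.starProjection_eq_self_iff.2 hs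
      calc ‖(T (φ k)).starProjection ℓ - ℓ‖
          = ‖(L.starProjection - (T (φ k)).starProjection) ℓ‖ := by
            rw [_root_.sub_apply, h1, norm_sub_rev]
        _ ≤ _ := ContinuousLinearMap.le_opNorm _ _
    have hmem : ∀ k, (T (φ k)).starProjection ℓ ∈ tangentSpace A α p w (z (φ k)).fst I := fun k => by
      rw [← hφI k]
      exact tangent_le_tangentSpace hα hp₀ hp₁ hw (hT (φ k)) (Submodule.starProjection_apply_mem _ _)
    have hker := (reduced_mulVec_eq_zero_iff A α p w v I s.ofLp).2 ⟨fun i hi => ?_, fun i hi => ?_⟩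
    · have := (isUnit_matrix_iff _).1 hunit _ hker
      ext i
      exact congrFun this i
    · have h1 := ((continuous_pair_sheared A i).tendsto ℓ).comp hproj
      have h2 := ((continuous_pair_fst i).tendsto ℓ).comp hproj
      -- The curvature is continuous where `v i ≠ 0`; an active index with `v i = 0` has `p ∈ {0,
      -- 1}`, where it vanishes identically.
      have h3 : Tendsto (fun k => powCurvature (α * w i) p ((z (φ k)).fst i)) atTop
          (𝓝 (powCurvature (α * w i) p (v i))) := by
        rcases hact i hi with h | ⟨h, -⟩ | ⟨h, -⟩
        · have hc : ContinuousAt (powCurvature (α * w i) p) (v i) :=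
            continuousAt_const.mul (continuousAt_id.abs.rpow_const (Or.inl (abs_ne_zero.2 h)))
          exact hc.tendsto.comp (hx i)
        · simp [powCurvature, h]
        · simp [powCurvature, h]
      have h4 := tendsto_nhds_unique h1 ((h3.mul h2).congr fun k => ((hmem k).1 i hi).symm)
      simp [hℓ] at h4
      linarith
    · have h2 := ((continuous_pair_fst i).tendsto ℓ).comp hproj
      have h4 := tendsto_nhds_unique h2 (tendsto_const_nhds.congr fun k => ((hmem k).2 i hi).symm)
      simpa [hℓ] using h4
  · obtain ⟨k, hk⟩ := ((hx i).eventually_ne (by simpa [lowerIndexSet] using hi)).exists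
    exact (hmemI k i).2 hk

/-- The graph is a product after the shear, so approximating sequences can be chosen coordinatewise:
nonzero on `I`, zero off `I`, avoiding corners and crossings. They keep the curvatures on `I` fixed,
so the tangent spaces form a constant sequence. -/
lemma tangentSpace_mem_scDerivative (hα : 0 < α) (hp₀ : 0 ≤ p) (hp₁ : p ≤ 1) (hw : ∀ i, 0 < w i)
    {v : EuclideanSpace ℝ (Fin n)} (hv : 0 ∈ objectiveSubdiff A y α p w v) {I : Finset (Fin n)}
    (hI : lowerIndexSet v ⊆ I) (hI' : I ⊆ upperIndexSet α p w (fidelityGrad A y v) v) :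
    tangentSpace A α p w v I ∈ scDerivative (objectiveSubdiff A y α p w) v 0 := by
  have hr : ∀ i, -fidelityGrad A y v i ∈ powSubdiff (α * w i) p (v i) := fun i => by
    simpa using hv i
  have hex : ∀ i, ∃ a b : ℕ → ℝ, Tendsto a atTop (𝓝 (v i)) ∧
      Tendsto b atTop (𝓝 (-fidelityGrad A y v i)) ∧ ∀ k, b k ∈ powSubdiff (α * w i) p (a k) ∧
      (i ∈ I → powCurvature (α * w i) p (a k) = powCurvature (α * w i) p (v i)) ∧
      (i ∈ I ↔ a k ≠ 0) ∧ (a k = 0 → (p = 1 → |b k| < α * w i) ∧ (p = 0 → b k ≠ 0)) := by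
    intro i
    have hci := mul_pos hα (hw i)
    by_cases hi : i ∈ I
    · obtain ⟨a, b, ha, hb, h⟩ :=
        exists_approx_of_isActive hci (hr i) (mem_upperIndexSet_iff.1 (hI' hi))
      exact ⟨a, b, ha, hb, fun k => ⟨(h k).1, fun _ => (h k).2.2, by simp [hi, (h k).2.1],
        fun h0 => absurd h0 (h k).2.1⟩⟩
    · have hvi : v i = 0 := by
        by_contra hne
        exact hi (hI (by simpa [lowerIndexSet] using hne))
      have hri := hr i
      rw [hvi] at hri
      obtain ⟨b, hb, h⟩ := exists_approx_zero hci hri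
      exact ⟨fun _ => 0, b, by rw [hvi]; exact tendsto_const_nhds, hb, fun k =>
        ⟨(h k).1, fun h => absurd h hi, by simp [hi], fun _ => (h k).2⟩⟩
  choose a b ha hb h using hex
  let X : ℕ → EuclideanSpace ℝ (Fin n) := fun k => WithLp.toLp 2 fun i => a i k
  -- Adding the gradient undoes the shear; the sum tends to `-r + r = 0`, with `r` the gradient at
  -- `v`.
  let S : ℕ → EuclideanSpace ℝ (Fin n) := fun k =>
    WithLp.toLp 2 fun i => b i k + fidelityGrad A y (X k) i
  have hX : Tendsto X atTop (𝓝 v) :=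
    ((PiLp.continuous_toLp 2 _).tendsto v.ofLp).comp (tendsto_pi_nhds.2 ha)
  have hS : Tendsto S atTop (𝓝 0) := by
    refine ((PiLp.continuous_toLp 2 _).tendsto (0 : EuclideanSpace ℝ (Fin n)).ofLp).comp
      (tendsto_pi_nhds.2 fun i => ?_)
    have := (hb i).add
      ((((continuous_apply i).comp (continuous_fidelityGrad A y)).tendsto v).comp hX)
    simpa using this
  refine ⟨finrank_tangentSpace _ _, fun k => WithLp.toLp 2 (X k, S k),
    fun _ => tangentSpace A α p w v I, fun k => ?_, ?_, ?_⟩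
  · have hlow : lowerIndexSet (X k) = I := by
      ext i
      simpa [lowerIndexSet, X] using (h i k).2.2.1.symm
    have heq : tangentSpace A α p w v I
        = tangentSpace A α p w (X k) (lowerIndexSet (X k)) := by
      ext u
      rw [hlow, mem_tangentSpace, mem_tangentSpace]
      refine and_congr_left fun _ => forall₂_congr fun i hi => ?_
      rw [← (h i k).2.1 hi]
    rw [heq]
    have hbi : ∀ i, S k i - fidelityGrad A y (X k) i = b i k := fun i => by simp [S]
    refine isGraphTangentSpace_tangentSpace hα hp₀ hp₁ hw (z := WithLp.toLp 2 (X k, S k))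
      (fun i => ?_) (fun i hi => ?_) (fun i hi => ?_)
    · simpa only [WithLp.toLp_fst, WithLp.toLp_snd, hbi] using (h i k).1
    · simpa only [WithLp.toLp_fst, WithLp.toLp_snd, hbi] using ((h i k).2.2.2 hi).1
    · simpa only [WithLp.toLp_fst, WithLp.toLp_snd, hbi] using ((h i k).2.2.2 hi).2
  · exact ((WithLp.prod_continuous_toLp 2 _ _).tendsto (v, 0)).comp (hX.prodMk_nhds hS)
  · simp [distZ]

end SCD

theorem mainTheorem6 {m n : ℕ} (A : Matrix (Fin m) (Fin n) ℝ) (y : EuclideanSpace ℝ (Fin m))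
    (α p : ℝ) (hα : 0 < α) (hp₀ : 0 ≤ p) (hp₁ : p ≤ 1)
    (w : Fin n → ℝ) (hw : ∀ i, 0 < w i)
    (v : EuclideanSpace ℝ (Fin n))
    (hv : IsMinOn (SCD.objective A y α p w) Set.univ v) :
    (0 : EuclideanSpace ℝ (Fin n)) ∈ SCD.limitingSubdiff (SCD.objective A y α p w) v ∧
    (SCD.IsSCDRegularAt (SCD.limitingSubdiff (SCD.objective A y α p w)) v 0 ↔
      ∀ I : Finset (Fin n), SCD.lowerIndexSet v ⊆ I →
        I ⊆ SCD.upperIndexSet α p w (SCD.fidelityGrad A y v) v →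
        IsUnit ((2 : ℝ) • (SCD.matP I * Aᵀ * A * SCD.matP I) + SCD.matW α p w v I)) ∧
    (p = 0 ∨ p = 1 →
      ((∀ I : Finset (Fin n), SCD.lowerIndexSet v ⊆ I →
          I ⊆ SCD.upperIndexSet α p w (SCD.fidelityGrad A y v) v →
          IsUnit ((2 : ℝ) • (SCD.matP I * Aᵀ * A * SCD.matP I) + SCD.matW α p w v I)) ↔
        ∀ I : Finset (Fin n), SCD.lowerIndexSet v ⊆ I →
          I ⊆ SCD.upperIndexSet α p w (SCD.fidelityGrad A y v) v →
          IsUnit ((SCD.colSubmatrix A I)ᵀ * SCD.colSubmatrix A I))) := by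
  have h0 := SCD.zero_mem_limitingSubdiff_of_isMinOn hv
  refine ⟨h0, ?_, fun hp => forall₃_congr fun I _ _ =>
    SCD.isUnit_reduced_iff_isUnit_gram A α hp w v I⟩
  rw [SCD.limitingSubdiff_objective hα hp₁ hw] at h0 ⊢
  constructor
  · intro H I hI hI'
    rw [SCD.isUnit_matrix_iff]
    intro u hu
    obtain ⟨h1, h2⟩ := (SCD.reduced_mulVec_eq_zero_iff A α p w v I u).1 hu
    have hmem : (WithLp.toLp 2 (WithLp.toLp 2 u, 0) : SCD.PairSpace n)
        ∈ SCD.tangentSpace A α p w v I :=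
      SCD.mem_tangentSpace.2 ⟨fun i hi => by simpa using by linarith [h1 i hi], h2⟩
    have := (H (SCD.tangentSpace_mem_scDerivative hα hp₀ hp₁ hw h0 hI hI')).2 _ hmem
    ext i
    exact congrArg (fun x : EuclideanSpace ℝ (Fin n) => x i) this
  · intro H L hL
    exact ⟨hL.1, fun s hs => SCD.eq_zero_of_mem_scDerivative hα hp₀ hp₁ hw H hL hs⟩
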